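/- **Conventions.** An arithmetic (division-free) circuit over $\mathbb{Q}[x_1,\dots,x_m]$ is a finite directed acyclic graph with a distinguished output gate, in which every vertex either has fanin $0$ and is labeled by some $x_i$ or by a constant in $\{-1,0,1\}$, or has fanin $2$ and is labeled by $+$ or $\times$. Its size is the number of vertices, its depth is the length of a longest directed path, and $[\![\mathcal{C}]\!]\in\mathbb{Q}[x_1,\dots,x_m]$ is the polynomial computed at the output gate. A parametric Markov chain (pMC) $\mathcal{M}=(S,P)$ consists of $S=\{1,\dots,n\}$ and polynomials $p_{ij}=P(i,j)\in\mathbb{Q}[x_1,\dots,x_m]$. A valuation $v\in\mathbb{R}^m$ is graph preserving if $p_{ij}\not\equiv 0$ implies $0<p_{ij}(v)\le 1$, and $\sum_k p_{ik}(v)=1$ for all $i$. The size $|\mathcal{M}|$ is $\sum_{i,j}\|p_{ij}\|$, where $\|f\|=|\mathrm{supp}(f)|\cdot\max(1,\deg f)\cdot\mathrm{len}(f)$ and $\mathrm{len}(f)$ is the length of the binary expansion of the largest absolute value of a numerator or denominator (in lowest terms) of a nonzero coefficient of $f$ (so $\|0\|=0$). Assume that $n\ge 2$, that $n$ is the target state,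 that $n-1$ is the unique state from which $n$ cannot be reached in the graph with edges $\{(i,j): p_{ij}\not\equiv 0\}$, and that $\mathcal{M}$ has at least one graph-preserving valuation. The value functions $g_1,\dots,g_n$ are the rational functions in $\mathbb{Q}(x_1,\dots,x_m)$ that solve $(\mathbb{I}_n-A)\,\vec g=(0,\dots,0,1)^{\mathsf T}$, where $A_{ij}=p_{ij}$ for $i<n-1$ and $A_{ij}=0$ for $i\in\{n-1,n\}$. **Theorem.** There are absolute constants $k\in\mathbb{N}$ and $c\in\mathbb{R}$ such that for every such pMC $\mathcal{M}$, with $d=\max_{i,j}\deg p_{ij}$, there are families of circuits $\mathcal{N}_i,\mathcal{D}_i$ ($1\le i\le n$) over $\mathbb{Q}[x_1,\dots,x_m]$, each of size at most $|\mathcal{M}|^{k}$ and of depth at most $c\,\log(|\mathcal{M}|)\,\log(n\max(d,1))$, such that, for every $i$, $[\![\mathcal{D}_i]\!]$ is not the zero polynomial and does not vanish at any graph-preserving valuation, and the vector of rational functions $[\![\mathcal{N}_i]\!]/[\![\mathcal{D}_i]\!]$, $1\le i\le n$, is the unique vector of value functions; that is, $g_i=[\![\mathcal{N}_i]\!]/[\![\mathcal{D}_i]\!]$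 for every $i$. -/

import Mathlib

open scoped Matrix BigOperators

/-- Labels of circuit vertices: an indeterminate `x_i`, a constant from `{-1, 0, 1}`, or one of the
two ring operations. -/
inductive GateLabel (m : ℕ) where
  | var (i : Fin m)
  | const (c : SignType)
  | add
  | mul

/-- The labels allowed on input gates. -/
def GateLabel.IsInput {m : ℕ} : GateLabel m → Prop
  | .var _ => True
  | .const _ => True
  | .add => False
  | .mul => False

/-- A (division-free) arithmetic circuit over `ℚ[x_1, …, x_m]`: a finite labeled directed acyclic
graph, whose input gates have fanin `0`, whose computation gates have fanin `2`, and which has a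
distinguished output gate. `E u v` says that there is an edge from `u` to `v`. -/
structure Circuit (m : ℕ) where
  V : Type
  fintypeV : Fintype V
  E : V → V → Prop
  label : V → GateLabel m
  out : V
  acyclic : ∀ v, ¬ Relation.TransGen E v v
  fanin_input : ∀ v, (label v).IsInput → ∀ u, ¬ E u v
  fanin_computation : ∀ v, ¬ (label v).IsInput → {u | E u v}.ncard = 2

namespace Circuit

variable {m : ℕ}

instance (C : Circuit m) : Fintype C.V := C.fintypeV

theorem wellFounded_E (C : Circuit m) : WellFounded C.E := by
  have : IsTrans C.V (Relation.TransGen C.E) := ⟨fun _ _ _ => Relation.TransGen.trans⟩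
  have : Std.Irrefl (Relation.TransGen C.E) := ⟨C.acyclic⟩
  exact Subrelation.wf Relation.TransGen.single
    (Finite.wellFounded_of_trans_of_irrefl (Relation.TransGen C.E))

/-- The number of vertices. -/
def size (C : Circuit m) : ℕ := Fintype.card C.V

open Classical in
/-- The polynomial computed by a vertex: the label of an input gate, and the sum (product) over all
predecessors for an addition (multiplication) gate. -/
noncomputable def sem (C : Circuit m) : C.V → MvPolynomial (Fin m) ℚ :=
  C.wellFounded_E.fix fun v ih =>
    match C.label v with
    | .var i => MvPolynomial.X i
    | .const c => MvPolynomial.C (c : ℚ)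
    | .add => ∑ u : {u // C.E u v}, ih u.1 u.2
    | .mul => ∏ u : {u // C.E u v}, ih u.1 u.2

/-- The polynomial computed by the output gate. -/
noncomputable def poly (C : Circuit m) : MvPolynomial (Fin m) ℚ := C.sem C.out

open Classical in
/-- The number of edges on a longest directed path that ends in a given vertex. -/
noncomputable def height (C : Circuit m) : C.V → ℕ :=
  C.wellFounded_E.fix fun v ih =>
    Finset.univ.sup fun u : {u // C.E u v} => ih u.1 u.2 + 1

/-- The number of edges on a longest directed path of the circuit. -/
noncomputable def depth (C : Circuit m) : ℕ := Finset.univ.sup C.height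

end Circuit

/-- The largest absolute value of a numerator or a denominator of a nonzero coefficient (written in
lowest terms), and `0` for the zero polynomial. -/
noncomputable def maxCoeff {m : ℕ} (f : MvPolynomial (Fin m) ℚ) : ℕ :=
  f.support.sup fun a => max (f.coeff a).num.natAbs (f.coeff a).den

/-- The representation size of a polynomial, given as a sum of products with coefficients in binary
and exponents in unary. `Nat.size` is the length of the binary expansion; constants have exponent
length `1`, so that no nonzero polynomial has size `0`. -/
noncomputable def repSize {m : ℕ} (f : MvPolynomial (Fin m) ℚ) : ℕ :=
  f.support.card * max f.totalDegree 1 * Nat.size (maxCoeff f)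

/-- A parametric Markov chain with `n` states and `m` parameters. The states `1, …, n` are the
elements `0, …, n - 1` of `Fin n`. -/
structure PMC (n m : ℕ) where
  P : Fin n → Fin n → MvPolynomial (Fin m) ℚ

namespace PMC

variable {n m : ℕ}

/-- The encoding size of the chain. -/
noncomputable def size (M : PMC n m) : ℕ := ∑ i, ∑ j, repSize (M.P i j)

/-- The maximal degree of a transition polynomial. -/
noncomputable def maxDeg (M : PMC n m) : ℕ :=
  Finset.univ.sup fun i => Finset.univ.sup fun j => (M.P i j).totalDegree

/-- Graph-preserving valuations of the parameters. -/
def GraphPreserving (M : PMC n m) (v : Fin m → ℝ) : Prop :=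
  (∀ i j, M.P i j ≠ 0 →
    0 < MvPolynomial.aeval v (M.P i j) ∧ MvPolynomial.aeval v (M.P i j) ≤ 1) ∧
  ∀ i, ∑ k, MvPolynomial.aeval v (M.P i k) = 1

/-- There is a path from `i` to `j` in the graph of the nonzero transitions. -/
def Reaches (M : PMC n m) (i j : Fin n) : Prop :=
  Relation.ReflTransGen (fun a b => M.P a b ≠ 0) i j

/-- The last state is the target, and the last but one is the unique state that does not reach
it. -/
def Normalized (M : PMC n m) : Prop :=
  2 ≤ n ∧ ∀ i t : Fin n, (t : ℕ) + 1 = n → (M.Reaches i t ↔ (i : ℕ) + 2 ≠ n)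

/-- The matrix `A` of the reachability equations: the transition matrix, with the rows of the last
two states replaced by `0`. -/
noncomputable def reachMatrix (M : PMC n m) :
    Matrix (Fin n) (Fin n) (FractionRing (MvPolynomial (Fin m) ℚ)) :=
  Matrix.of fun i j => if (i : ℕ) + 2 < n then algebraMap _ _ (M.P i j) else 0

/-- `g` is a vector of (reachability) value functions: rational functions that solve
`(I - A) g = (0, …, 0, 1)`. -/
def IsValueFunctions (M : PMC n m)
    (g : Fin n → FractionRing (MvPolynomial (Fin m) ℚ)) : Prop :=
  ((1 : Matrix (Fin n) (Fin n) (FractionRing (MvPolynomial (Fin m) ℚ))) - M.reachMatrix) *ᵥ g =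
    fun i : Fin n => if (i : ℕ) + 1 = n then 1 else 0

end PMC

/-! The value functions are given by Cramer's rule. Multiplying both sides of `(1 - A) g = e_n` by
the product `denProd` of all coefficient denominators makes all coefficients integral without
changing the solution. Each numerator is then the determinant with column `i` replaced by the
right-hand side, and one common denominator is the determinant of the scaled matrix.

The denominator vanishes at no graph-preserving valuation by a maximum principle
(`eq_zero_of_evalMatrix_mulVec`): a vector fixed by `A` is averaged by the remaining stochastic rows
and is zero at the last two states, so reachability forces it to be zero.

Determinants are computed without division by Chistov's method (`Computes.det`), in depth `O(log²
n)`. The entries cost depth `O(log |M|)` from the binary expansions of their coefficients. Since `n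
≤ |M|` (`le_size`), one factor `log n` is charged to `log |M|` and the other to `log (n max(d,1))`.

Costs are counted for programs, which are finite sets of pairs (value, level) over any ring;
sharing, parallel and sequential composition are then unions of sets. Only at the end are programs
turned into circuits (`Computes.exists_circuit`). -/

/-! ### Straight-line programs with size and depth -/

/-- `r` is available below level `l`: it belongs to `A`, or is computed by a gate of `F` of level
less than `l`. -/
def Available {R : Type*} (A : Set R) (F : Finset (R × ℕ)) (l : ℕ) (r : R) : Prop :=
  r ∈ A ∨ ∃ l' < l, (r, l') ∈ F

/-- All elements of `B` can be computed from those of `A` by a program of at most `s` ring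
operations of depth at most `t`. -/
def Computes {R : Type*} [Add R] [Mul R] (A B : Set R) (s t : ℕ) : Prop :=
  ∃ F : Finset (R × ℕ), F.card ≤ s ∧
    (∀ x ∈ F, x.2 < t ∧ ∃ o : Bool → R, (∀ b, Available A F x.2 (o b)) ∧
      (x.1 = o false + o true ∨ x.1 = o false * o true)) ∧
    ∀ b ∈ B, Available A F t b

theorem Available.mono {R : Type*} {A A' : Set R} {F F' : Finset (R × ℕ)} {l l' : ℕ} {r : R}
    (h : Available A F l r) (hA : A ⊆ A') (hF : F ⊆ F') (hl : l ≤ l') : Available A' F' l' r := by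
  rcases h with h | ⟨k, hk, h⟩
  · exact Or.inl (hA h)
  · exact Or.inr ⟨k, hk.trans_le hl, hF h⟩

namespace Computes

section Basic

variable {R : Type*} [Add R] [Mul R] {A A' B B' C : Set R} {s s' t t' : ℕ}

theorem of_subset (h : B ⊆ A) : Computes A B 0 0 :=
  ⟨∅, by simp, by simp, fun _ hb => Or.inl (h hb)⟩

theorem mono (h : Computes A B s t) (hA : A ⊆ A') (hB : B' ⊆ B) (hs : s ≤ s') (ht : t ≤ t') :
    Computes A' B' s' t' := by
  obtain ⟨F, hc, hF, hFB⟩ := h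
  refine ⟨F, hc.trans hs, fun x hx => ?_, fun b hb => (hFB b (hB hb)).mono hA subset_rfl ht⟩
  obtain ⟨hl, o, ho, he⟩ := hF x hx
  exact ⟨hl.trans_le ht, o, fun b => (ho b).mono hA subset_rfl le_rfl, he⟩

theorem weaken (h : Computes A B s t) (hs : s ≤ s') (ht : t ≤ t') : Computes A B s' t' :=
  h.mono subset_rfl subset_rfl hs ht

theorem keep (h : Computes A B s t) : Computes A (A ∪ B) s t := by
  obtain ⟨F, hc, hF, hFB⟩ := h
  exact ⟨F, hc, hF, fun b hb => hb.elim Or.inl (hFB b)⟩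

open Classical in
theorem trans (h : Computes A B s t) (h' : Computes B C s' t') :
    Computes A C (s + s') (t + t') := by
  obtain ⟨F, hc, hF, hFB⟩ := h
  obtain ⟨F', hc', hF', hFB'⟩ := h'
  -- The second program is lifted by `t` levels, so that every output of the first lies strictly
  -- below its gates.
  set G := F ∪ F'.image (fun x => (x.1, x.2 + t)) with hG
  have key : ∀ l r, Available B F' l r → Available A G (l + t) r := by
    rintro l r (h | ⟨l', hl', h⟩)
    · exact (hFB r h).mono subset_rfl Finset.subset_union_left (by omega)
    · exact Or.inr ⟨l' + t, by omega,
        Finset.mem_union_right _ (Finset.mem_image_of_mem (fun x : R × ℕ => (x.1, x.2 + t)) h)⟩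
  refine ⟨G, ?_, fun x hx => ?_, fun b hb => ?_⟩
  · exact (Finset.card_union_le _ _).trans (add_le_add hc (Finset.card_image_le.trans hc'))
  · rcases Finset.mem_union.1 hx with hx | hx
    · obtain ⟨hl, o, ho, he⟩ := hF x hx
      exact ⟨by omega, o, fun b => (ho b).mono subset_rfl Finset.subset_union_left le_rfl, he⟩
    · obtain ⟨y, hy, rfl⟩ := Finset.mem_image.1 hx
      obtain ⟨hl, o, ho, he⟩ := hF' y hy
      exact ⟨by simp; omega, o, fun b => key _ _ (ho b), he⟩
  · rw [add_comm]
    exact key _ _ (hFB' b hb)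

theorem trans_union (h : Computes A B s t) (h' : Computes (A ∪ B) C s' t') :
    Computes A C (s + s') (t + t') :=
  h.keep.trans h'

open Classical in
theorem union (h : Computes A B s t) (h' : Computes A C s' t) : Computes A (B ∪ C) (s + s') t := by
  obtain ⟨F, hc, hF, hFB⟩ := h
  obtain ⟨F', hc', hF', hFB'⟩ := h'
  refine ⟨F ∪ F', (Finset.card_union_le _ _).trans (add_le_add hc hc'), fun x hx => ?_, ?_⟩
  · rcases Finset.mem_union.1 hx with hx | hx
    · obtain ⟨hl, o, ho, he⟩ := hF x hx
      exact ⟨hl, o, fun b => (ho b).mono subset_rfl Finset.subset_union_left le_rfl, he⟩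
    · obtain ⟨hl, o, ho, he⟩ := hF' x hx
      exact ⟨hl, o, fun b => (ho b).mono subset_rfl Finset.subset_union_right le_rfl, he⟩
  · rintro b (hb | hb)
    · exact (hFB b hb).mono subset_rfl Finset.subset_union_left le_rfl
    · exact (hFB' b hb).mono subset_rfl Finset.subset_union_right le_rfl

open Classical in
theorem biUnion {ι : Type*} (S : Finset ι) {B : ι → Set R} (h : ∀ i ∈ S, Computes A (B i) s t) :
    Computes A (⋃ i ∈ S, B i) (S.card * s) t := by
  induction S using Finset.induction_on with
  | empty => exact (of_subset (by simp)).weaken (by simp) (by simp)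
  | insert a S ha ih =>
    rw [Finset.set_biUnion_insert, Finset.card_insert_of_notMem ha, add_comm, add_mul, one_mul]
    exact (h a (by simp)).union (ih fun i hi => h i (by simp [hi]))

theorem image {ι : Type*} (S : Finset ι) {f : ι → R} (h : ∀ i ∈ S, Computes A {f i} s t) :
    Computes A (f '' S) (S.card * s) t := by
  refine (biUnion S h).mono subset_rfl ?_ le_rfl le_rfl
  rintro _ ⟨i, hi, rfl⟩
  exact Set.mem_biUnion hi rfl

theorem add {x y : R} (hx : x ∈ A) (hy : y ∈ A) : Computes A {x + y} 1 1 := by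
  refine ⟨{(x + y, 0)}, by simp, ?_, ?_⟩
  · simp only [Finset.mem_singleton, forall_eq, Nat.lt_one_iff, true_and]
    exact ⟨fun b => cond b y x, by rintro (_ | _) <;> [exact Or.inl hx; exact Or.inl hy],
      Or.inl rfl⟩
  · rintro _ rfl
    exact Or.inr ⟨0, by simp⟩

theorem mul {x y : R} (hx : x ∈ A) (hy : y ∈ A) : Computes A {x * y} 1 1 := by
  refine ⟨{(x * y, 0)}, by simp, ?_, ?_⟩
  · simp only [Finset.mem_singleton, forall_eq, Nat.lt_one_iff, true_and]
    exact ⟨fun b => cond b y x, by rintro (_ | _) <;> [exact Or.inl hx; exact Or.inl hy],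
      Or.inr rfl⟩
  · rintro _ rfl
    exact Or.inr ⟨0, by simp⟩

theorem mul' {x y : R} (hx : Computes A {x} s t) (hy : Computes A {y} s' t) :
    Computes A {x * y} (s + s' + 1) (t + 1) :=
  (hx.union hy).trans (mul (by simp) (by simp))

/-- Products of lists are computed along a balanced binary tree. -/
theorem list_prod {M : Type*} [Monoid M] (co : M → Set R) {w h : ℕ}
    (step : ∀ A', A ⊆ A' → ∀ x y, co x ⊆ A' → co y ⊆ A' → Computes A' (co (x * y)) w h)
    (one : co 1 ⊆ A) (r : ℕ) (l : List M) (hr : l.length ≤ 2 ^ r) (hl : ∀ x ∈ l, co x ⊆ A) :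
    Computes A (co l.prod) (l.length * w) (r * h) := by
  rcases eq_or_ne l [] with rfl | hne
  · exact (of_subset (by simpa using one)).weaken (by simp) (by simp)
  -- A nonempty product takes one multiplication fewer than it has factors; this sharper count is
  -- what survives the splitting into halves.
  suffices H : Computes A (co l.prod) ((l.length - 1) * w) (r * h) from
    H.weaken (Nat.mul_le_mul_right _ (Nat.sub_le _ _)) le_rfl
  induction r generalizing l with
  | zero =>
    obtain ⟨a, rfl⟩ : ∃ a, l = [a] := by
      rw [← List.length_eq_one_iff]
      have := List.length_pos_iff.2 hne
      simp at hr
      omega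
    exact (of_subset (by simpa using hl)).weaken (by simp) (by simp)
  | succ r ih =>
    by_cases hlen : l.length ≤ 2 ^ r
    · exact (ih l hlen hl hne).weaken le_rfl (Nat.mul_le_mul_right _ (Nat.le_succ r))
    have h2 : 0 < 2 ^ r := by positivity
    have e1 : (l.take (2 ^ r)).length = 2 ^ r := by simp; omega
    have e2 : (l.drop (2 ^ r)).length = l.length - 2 ^ r := by simp
    have i1 := ih (l.take (2 ^ r)) e1.le (fun x hx => hl x (List.mem_of_mem_take hx))
      (by rw [← List.length_pos_iff]; omega)
    have i2 := ih (l.drop (2 ^ r)) (by rw [pow_succ] at hr; omega)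
      (fun x hx => hl x (List.mem_of_mem_drop hx)) (by rw [← List.length_pos_iff]; omega)
    have := (i1.union i2).trans_union (step _ Set.subset_union_left (l.take (2 ^ r)).prod
      (l.drop (2 ^ r)).prod (fun x hx => by simp [hx]) (fun x hx => by simp [hx]))
    rw [List.prod_take_mul_prod_drop] at this
    refine this.weaken ?_ (by rw [add_mul, one_mul])
    rw [e1, e2, ← add_mul, ← Nat.succ_mul]
    exact Nat.mul_le_mul_right _ (by omega)

end Basic

/-! ### Balanced sums and products, also of matrices and truncated power series -/

section Semiring

variable {R : Type*} [CommSemiring R] {A : Set R} {s t r : ℕ}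

theorem sum_mem {ι : Type*} (S : Finset ι) {f : ι → R} (h0 : (0 : R) ∈ A) (hS : S.card ≤ 2 ^ r)
    (h : ∀ i ∈ S, f i ∈ A) : Computes A {∑ i ∈ S, f i} S.card r := by
  -- A sum is a product in `Multiplicative R`, so the same balanced tree serves.
  have := list_prod (A := A) (M := Multiplicative R) (fun x => {x.toAdd}) (w := 1) (h := 1)
    (fun A' _ x y hx hy => by
      simp only [toAdd_mul]
      exact add (by simpa using hx) (by simpa using hy)) (by simpa using h0) r
    (S.toList.map fun i => Multiplicative.ofAdd (f i)) (by simpa using hS) (by simpa using h)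
  have e : (S.toList.map fun i => Multiplicative.ofAdd (f i)).prod =
      Multiplicative.ofAdd (∑ i ∈ S, f i) := by
    rw [← Finset.sum_map_toList, ofAdd_list_prod, List.map_map]
    rfl
  simpa [e] using this

theorem prod_mem {ι : Type*} (S : Finset ι) {f : ι → R} (h1 : (1 : R) ∈ A) (hS : S.card ≤ 2 ^ r)
    (h : ∀ i ∈ S, f i ∈ A) : Computes A {∏ i ∈ S, f i} S.card r := by
  have := list_prod (A := A) (M := R) (fun x => {x}) (w := 1) (h := 1)
    (fun A' _ x y hx hy => mul (by simpa using hx) (by simpa using hy)) (by simpa using h1) r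
    (S.toList.map f) (by simpa using hS) (by simpa using h)
  simpa [Finset.prod_map_toList] using this

theorem sum {ι : Type*} (S : Finset ι) {f : ι → R} (h0 : (0 : R) ∈ A) (hS : S.card ≤ 2 ^ r)
    (h : ∀ i ∈ S, Computes A {f i} s t) :
    Computes A {∑ i ∈ S, f i} (S.card * (s + 1)) (t + r) := by
  refine ((image S h).trans_union (sum_mem S (Or.inl h0) hS fun i hi =>
    Or.inr ⟨i, hi, rfl⟩)).weaken ?_ le_rfl
  rw [mul_add, mul_one]

theorem prod {ι : Type*} (S : Finset ι) {f : ι → R} (h1 : (1 : R) ∈ A) (hS : S.card ≤ 2 ^ r)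
    (h : ∀ i ∈ S, Computes A {f i} s t) :
    Computes A {∏ i ∈ S, f i} (S.card * (s + 1)) (t + r) := by
  refine ((image S h).trans_union (prod_mem S (Or.inl h1) hS fun i hi =>
    Or.inr ⟨i, hi, rfl⟩)).weaken ?_ le_rfl
  rw [mul_add, mul_one]

/-- Products in a monoid whose multiplication is given by bilinear forms in coordinates. -/
theorem list_prod_of_bilinear {M κ τ : Type*} [Monoid M] (K : Finset κ) (c : M → κ → R)
    (T : κ → Finset τ) (left right : κ → τ → κ) {w : ℕ}
    (hT : ∀ k ∈ K, (T k).card ≤ w) (hw : w ≤ 2 ^ r)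
    (hleft : ∀ k ∈ K, ∀ p ∈ T k, left k p ∈ K) (hright : ∀ k ∈ K, ∀ p ∈ T k, right k p ∈ K)
    (hmul : ∀ x y, ∀ k ∈ K, c (x * y) k = ∑ p ∈ T k, c x (left k p) * c y (right k p))
    (h0 : (0 : R) ∈ A) (one : c 1 '' K ⊆ A) (q : ℕ) (l : List M) (hq : l.length ≤ 2 ^ q)
    (hl : ∀ x ∈ l, c x '' K ⊆ A) :
    Computes A (c l.prod '' K) (l.length * (K.card * (2 * w))) (q * (1 + r)) := by
  refine list_prod (fun x => c x '' K) (fun A' hA x y hx hy => ?_) one q l hq hl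
  refine image K fun k hk => ?_
  rw [hmul x y k hk]
  refine (sum (T k) (hA h0) ((hT k hk).trans hw) fun p hp => mul (hx ⟨_, hleft k hk p hp, rfl⟩)
    (hy ⟨_, hright k hk p hp, rfl⟩)).weaken ?_ le_rfl
  have := hT k hk
  omega

theorem matrix_prod {ν : Type*} [Fintype ν] [DecidableEq ν] (hν : Fintype.card ν ≤ 2 ^ r)
    (h0 : (0 : R) ∈ A) (h1 : (1 : R) ∈ A) (q : ℕ) (l : List (Matrix ν ν R))
    (hq : l.length ≤ 2 ^ q) (hl : ∀ x ∈ l, ∀ i j, x i j ∈ A) :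
    Computes A (Set.range fun p : ν × ν => l.prod p.1 p.2)
      (l.length * (Fintype.card ν * Fintype.card ν * (2 * Fintype.card ν))) (q * (1 + r)) := by
  have := list_prod_of_bilinear (A := A) (M := Matrix ν ν R) (Finset.univ : Finset (ν × ν))
    (fun x p => x p.1 p.2) (fun _ => (Finset.univ : Finset ν)) (fun k m => (k.1, m))
    (fun k m => (m, k.2)) (w := Fintype.card ν) (by simp) hν (by simp) (by simp)
    (fun x y k _ => Matrix.mul_apply) h0
    (by
      rintro _ ⟨p, -, rfl⟩
      simp only [Matrix.one_apply]
      split_ifs <;> assumption) q l hq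
    (by
      rintro x hx _ ⟨p, -, rfl⟩
      exact hl x hx _ _)
  simpa using this

/-- Coefficients up to `N` of a product involve only coefficients up to `N` of the factors, so
truncation costs nothing. -/
theorem powerSeries_prod (N : ℕ) (hN : N + 1 ≤ 2 ^ r) (h0 : (0 : R) ∈ A) (h1 : (1 : R) ∈ A)
    (q : ℕ) (l : List (PowerSeries R)) (hq : l.length ≤ 2 ^ q)
    (hl : ∀ x ∈ l, ∀ i ≤ N, PowerSeries.coeff i x ∈ A) :
    Computes A ((fun i => PowerSeries.coeff i l.prod) '' Finset.range (N + 1))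
      (l.length * ((N + 1) * (2 * (N + 1)))) (q * (1 + r)) := by
  have := list_prod_of_bilinear (A := A) (M := PowerSeries R) (Finset.range (N + 1))
    (fun x i => PowerSeries.coeff i x) (fun k => Finset.HasAntidiagonal.antidiagonal k)
    (fun _ p => p.1) (fun _ p => p.2) (w := N + 1) (fun k hk => by simpa using hk) hN
    (fun k hk p hp => by simp at hk hp ⊢; omega) (fun k hk p hp => by simp at hk hp ⊢; omega)
    (fun x y k _ => PowerSeries.coeff_mul k x y) h0
    (by
      rintro _ ⟨p, -, rfl⟩
      simp only [PowerSeries.coeff_one]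
      split_ifs <;> assumption) q l hq
    (by
      rintro x hx _ ⟨p, hp, rfl⟩
      exact hl x hx _ (by simp at hp; omega))
  simpa using this

end Semiring

end Computes

/-! ### From programs to circuits -/

/-- The variables and the constants `-1`, `0`, `1`. -/
def circuitInputs (m : ℕ) : Set (MvPolynomial (Fin m) ℚ) :=
  Set.range MvPolynomial.X ∪ Set.range fun c : SignType => MvPolynomial.C (c : ℚ)

/-- The polynomial of an input label, and `0` for operations. -/
noncomputable def GateLabel.inputValue {m : ℕ} : GateLabel m → MvPolynomial (Fin m) ℚ
  | .var i => MvPolynomial.X i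
  | .const c => MvPolynomial.C (c : ℚ)
  | .add => 0
  | .mul => 0

theorem exists_label_of_mem_circuitInputs {m : ℕ} {f : MvPolynomial (Fin m) ℚ}
    (h : f ∈ circuitInputs m) : ∃ g : GateLabel m, g.IsInput ∧ g.inputValue = f := by
  rcases h with ⟨i, rfl⟩ | ⟨c, rfl⟩
  · exact ⟨.var i, trivial, rfl⟩
  · exact ⟨.const c, trivial, rfl⟩

namespace Circuit

variable {m : ℕ} (C : Circuit m)

theorem sem_of_isInput {v : C.V} (h : (C.label v).IsInput) : C.sem v = (C.label v).inputValue := by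
  rw [sem, WellFounded.fix_eq]
  cases e : C.label v <;> simp_all [GateLabel.IsInput, GateLabel.inputValue]

theorem sem_of_add {v a b : C.V} (h : C.label v = .add) (hab : a ≠ b)
    (hE : ∀ u, C.E u v ↔ u = a ∨ u = b) : C.sem v = C.sem a + C.sem b := by
  classical
  rw [sem, WellFounded.fix_eq]
  simp only [h]
  exact (Finset.sum_subtype ({a, b} : Finset C.V) (by simp [hE]) C.sem).symm.trans
    (Finset.sum_pair hab)

theorem sem_of_mul {v a b : C.V} (h : C.label v = .mul) (hab : a ≠ b)
    (hE : ∀ u, C.E u v ↔ u = a ∨ u = b) : C.sem v = C.sem a * C.sem b := by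
  classical
  rw [sem, WellFounded.fix_eq]
  simp only [h]
  exact (Finset.prod_subtype ({a, b} : Finset C.V) (by simp [hE]) C.sem).symm.trans
    (Finset.prod_pair hab)

theorem depth_le_of_rank {t : ℕ} (rank : C.V → ℕ) (hE : ∀ u v, C.E u v → rank u < rank v)
    (ht : ∀ v, rank v ≤ t) : C.depth ≤ t := by
  have key : ∀ k v, rank v = k → C.height v ≤ k := by
    intro k
    induction k using Nat.strong_induction_on with
    | _ k ih =>
      intro v hv
      rw [height, WellFounded.fix_eq]
      refine Finset.sup_le fun u _ => ?_
      have h := hE _ _ u.2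
      have := ih _ (by omega) u.1 rfl
      change C.height u.1 + 1 ≤ k
      omega
  exact Finset.sup_le fun v _ => (key _ v rfl).trans (ht v)

end Circuit

/-- Programs that compute from the variables and from `-1`, `0`, `1` are realized by circuits. -/
theorem Computes.exists_circuit {m s t : ℕ} {f : MvPolynomial (Fin m) ℚ}
    (h : Computes (circuitInputs m) {f} s t) :
    ∃ C : Circuit m, C.size ≤ 4 * s + 1 ∧ C.depth ≤ t ∧ C.poly = f := by
  classical
  obtain ⟨F, hc, hF, hf⟩ := h
  rcases hf f rfl with hf | ⟨l, hl, hf⟩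
  · obtain ⟨g, hg, rfl⟩ := exists_label_of_mem_circuitInputs hf
    let C : Circuit m :=
      { V := Unit
        fintypeV := inferInstance
        E := fun _ _ => False
        label := fun _ => g
        out := ()
        acyclic := by
          intro v hv
          cases hv <;> assumption
        fanin_input := by simp
        fanin_computation := fun _ h => (h hg).elim }
    refine ⟨C, ?_, ?_, ?_⟩
    · simp [Circuit.size, C]
    · exact (C.depth_le_of_rank (fun _ => 0) (fun _ _ h => h.elim) fun _ => le_rfl).trans
        (Nat.zero_le _)
    · exact C.sem_of_isInput (v := ()) hg
  -- Edges form a relation, so `x + x` and `x * x` need two distinct vertices of equal value. Each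
  -- gate `x` therefore gets four vertices `(x, kind, side)`: two copies of the gate (`kind = true`)
  -- and two private input leaves (`kind = false`). The operand on side `b` is read from a vertex of
  -- side `b`, which keeps the two predecessors distinct.
  · have hF' : ∀ x : F, ∃ (o : Bool → MvPolynomial (Fin m) ℚ) (src : Bool → F × Bool × Bool)
        (lab : Bool → GateLabel m) (op : GateLabel m),
        (∀ b, (lab b).IsInput) ∧ (∀ b, (src b).2.2 = b) ∧
        (∀ b, src b = (x, false, b) ∧ (lab b).inputValue = o b ∨
          (src b).2.1 = true ∧ (src b).1.1.2 < x.1.2 ∧ (src b).1.1.1 = o b) ∧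
        (op = .add ∧ x.1.1 = o false + o true ∨ op = .mul ∧ x.1.1 = o false * o true) := by
      intro x
      obtain ⟨-, o, ho, he⟩ := hF x.1 x.2
      have : ∀ b, ∃ (v : F × Bool × Bool) (g : GateLabel m), g.IsInput ∧ v.2.2 = b ∧
          (v = (x, false, b) ∧ g.inputValue = o b ∨
            v.2.1 = true ∧ v.1.1.2 < x.1.2 ∧ v.1.1.1 = o b) := by
        intro b
        rcases ho b with hb | ⟨l', hl', hb⟩
        · obtain ⟨g, hg, hgb⟩ := exists_label_of_mem_circuitInputs hb
          exact ⟨(x, false, b), g, hg, rfl, Or.inl ⟨rfl, hgb⟩⟩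
        -- The leaf on this side is not read, so its label is an arbitrary input label.
        · exact ⟨(⟨(o b, l'), hb⟩, true, b), .const 0, trivial, rfl, Or.inr ⟨rfl, hl', rfl⟩⟩
      choose src lab h1 h2 h3 using this
      rcases he with he | he
      · exact ⟨o, src, lab, .add, h1, h2, h3, Or.inl ⟨rfl, he⟩⟩
      · exact ⟨o, src, lab, .mul, h1, h2, h3, Or.inr ⟨rfl, he⟩⟩
    choose o src lab op hlab hside hsrc hop using hF'
    let rank : F × Bool × Bool → ℕ := fun v => if v.2.1 then v.1.1.2 + 1 else 0
    have hrank : ∀ u v : F × Bool × Bool, v.2.1 = true ∧ (∃ b, u = src v.1 b) →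
        rank u < rank v := by
      rintro u v ⟨hv, b, rfl⟩
      simp only [rank, hv, if_true]
      rcases hsrc v.1 b with h | h
      · simp [h.1]
      · simp [h.1, h.2.1]
    have hne : ∀ x, src x false ≠ src x true := fun x e => by
      have := congrArg (fun v => v.2.2) e
      simp [hside] at this
    let C : Circuit m :=
      { V := F × Bool × Bool
        fintypeV := inferInstance
        E := fun u v => v.2.1 = true ∧ ∃ b, u = src v.1 b
        label := fun v => if v.2.1 then op v.1 else lab v.1 v.2.2
        out := (⟨(f, l), hf⟩, true, true)
        acyclic := by
          have : ∀ u v : F × Bool × Bool, Relation.TransGen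
              (fun u v : F × Bool × Bool => v.2.1 = true ∧ ∃ b, u = src v.1 b) u v →
              rank u < rank v := by
            intro u v h
            induction h with
            | single h => exact hrank _ _ h
            | tail _ h ih => exact ih.trans (hrank _ _ h)
          exact fun v hv => lt_irrefl _ (this _ _ hv)
        fanin_input := by
          rintro ⟨x, _ | _, b⟩ hv u ⟨hu, -⟩
          · simp at hu
          · rcases hop x with h | h <;> simp [h.1, GateLabel.IsInput] at hv
        fanin_computation := by
          rintro ⟨x, _ | _, b⟩ hv
          · exact (hv (by simpa using hlab x b)).elim
          · have : {u | ((x, true, b) : F × Bool × Bool).2.1 = true ∧ ∃ b', u = src x b'} =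
                {src x false, src x true} := by
              ext u
              simp
            rw [this]
            exact Set.ncard_pair (hne x) }
    have hE : ∀ x b (u : C.V), C.E u (x, true, b) ↔ u = src x false ∨ u = src x true := by
      intro x b u
      simp [C]
    have hin : ∀ x b, C.sem (x, false, b) = (lab x b).inputValue := fun x b =>
      C.sem_of_isInput (v := (x, false, b)) (hlab x b)
    have hgate : ∀ k (x : F), x.1.2 = k → ∀ b, C.sem (x, true, b) = x.1.1 := by
      intro k
      induction k using Nat.strong_induction_on with
      | _ k ih =>
        intro x hx b
        have hs : ∀ b, C.sem (src x b) = o x b := by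
          intro b
          rcases hsrc x b with h | h
          · rw [h.1, hin, h.2]
          · rw [← h.2.2, ← ih _ (by omega) (src x b).1 rfl (src x b).2.2]
            conv_rhs => rw [← h.1]
        rcases hop x with h | h
        · rw [C.sem_of_add (v := (x, true, b)) h.1 (hne x) (hE x b), hs, hs, h.2]
        · rw [C.sem_of_mul (v := (x, true, b)) h.1 (hne x) (hE x b), hs, hs, h.2]
    refine ⟨C, ?_, ?_, ?_⟩
    · have : C.size = F.card * 4 := by
        change Fintype.card (F × Bool × Bool) = _
        simp
      omega
    · refine C.depth_le_of_rank rank hrank fun v => ?_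
      have := (hF v.1.1 v.1.2).1
      simp only [rank]
      split_ifs <;> omega
    · exact hgate _ _ rfl _

/-! ### Chistov's division-free determinant -/

section Chistov

open PowerSeries

variable {R : Type*} [CommRing R] {n : ℕ}

/-- The matrix `A` with its rows of index at least `k` replaced by `0`. -/
def truncRows (A : Matrix (Fin n) (Fin n) R) (k : ℕ) : Matrix (Fin n) (Fin n) R :=
  Matrix.of fun i j => if (i : ℕ) < k then A i j else 0

/-- The matrix `1 - z A` over the ring of formal power series in `z`. -/
noncomputable def oneSubX (A : Matrix (Fin n) (Fin n) R) : Matrix (Fin n) (Fin n) R⟦X⟧ :=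
  1 - (X : R⟦X⟧) • A.map (C : R →+* R⟦X⟧)

/-- The geometric series `∑ z ^ j A ^ j`. -/
noncomputable def geomSeries (A : Matrix (Fin n) (Fin n) R) : Matrix (Fin n) (Fin n) R⟦X⟧ :=
  Matrix.of fun i j => PowerSeries.mk fun k => (A ^ k) i j

theorem oneSubX_mul_geomSeries (A : Matrix (Fin n) (Fin n) R) :
    oneSubX A * geomSeries A = 1 := by
  rw [oneSubX, sub_mul, one_mul, Matrix.smul_mul]
  ext i j k
  have hsum : (A.map (C : R →+* R⟦X⟧) * geomSeries A) i j =
      PowerSeries.mk fun k => (A ^ (k + 1)) i j := by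
    ext k
    simp [Matrix.mul_apply, geomSeries, pow_succ']
  rw [Matrix.sub_apply, Matrix.smul_apply, hsum, smul_eq_mul]
  cases k with
  | zero =>
    simp only [geomSeries, Matrix.of_apply, map_sub, coeff_mk, coeff_zero_X_mul, sub_zero, pow_zero,
      Matrix.one_apply]
    split_ifs <;> simp
  | succ k =>
    simp only [geomSeries, Matrix.of_apply, map_sub, coeff_mk, coeff_succ_X_mul, sub_self,
      Matrix.one_apply]
    split_ifs <;> simp [coeff_one]

theorem oneSubX_truncRows_updateRow (A : Matrix (Fin n) (Fin n) R) (k : Fin n) :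
    (oneSubX (truncRows A (k + 1))).updateRow k (Pi.single k 1) = oneSubX (truncRows A k) := by
  ext1 i j
  rcases eq_or_ne i k with rfl | h
  · simp [oneSubX, truncRows, Matrix.one_apply, Pi.single_apply, eq_comm]
  · have : i ≤ k ↔ i < k := ⟨fun hle => lt_of_le_of_ne hle h, le_of_lt⟩
    simp [oneSubX, truncRows, Matrix.updateRow_ne h, this]

/-- Cramer's rule for the diagonal entry `(k, k)` of the inverse of `1 - z A_{k+1}`, which is the
geometric series: the cofactor arises by putting a unit vector in row `k`, that is, by also zeroing
row `k` of `A`. -/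
theorem det_oneSubX_truncRows (A : Matrix (Fin n) (Fin n) R) (k : Fin n) :
    (oneSubX (truncRows A k)).det =
      (oneSubX (truncRows A (k + 1))).det * geomSeries (truncRows A (k + 1)) k k := by
  have h := congrArg (fun B => B k k) (congrArg ((oneSubX (truncRows A (k + 1))).adjugate * ·)
    (oneSubX_mul_geomSeries (truncRows A (k + 1))))
  simp only [mul_one, ← mul_assoc, Matrix.adjugate_mul, Matrix.smul_mul, one_mul,
    Matrix.smul_apply, smul_eq_mul] at h
  rw [h, Matrix.adjugate_apply, oneSubX_truncRows_updateRow]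

/-- The ratios of consecutive truncations telescope down to the zero matrix, where the determinant
is `1`. -/
theorem det_oneSubX_mul_prod (A : Matrix (Fin n) (Fin n) R) :
    (oneSubX A).det * ∏ k : Fin n, geomSeries (truncRows A (k + 1)) k k = 1 := by
  have key : ∀ l ≤ n, (oneSubX (truncRows A l)).det *
      ∏ k : Fin n with k.1 < l, geomSeries (truncRows A (k + 1)) k k = 1 := by
    intro l hl
    induction l with
    | zero =>
      have : truncRows A 0 = 0 := by ext; simp [truncRows]
      simp [this, oneSubX]
    | succ l ih =>
      have e : Finset.univ.filter (fun k : Fin n => k.1 < l + 1) =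
          insert ⟨l, hl⟩ (Finset.univ.filter (fun k : Fin n => k.1 < l)) := by
        ext k
        simp [Fin.ext_iff]
        omega
      rw [e, Finset.prod_insert (by simp), ← mul_assoc]
      have := det_oneSubX_truncRows A ⟨l, hl⟩
      simp only at this
      rw [← this]
      exact ih (by omega)
  have e : truncRows A n = A := by ext; simp [truncRows]
  simpa [e] using key n le_rfl

/-- Inversion without division: `1 / p = ∑ (1 - p) ^ j`, and since `1 - p` has no constant term, the
powers beyond `N` do not reach coefficient `N`. -/
theorem coeff_eq_sum_of_mul_eq_one {f p : R⟦X⟧} (h : f * p = 1) (hp : constantCoeff p = 1)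
    (N : ℕ) : coeff N f = ∑ j ∈ Finset.range (N + 1), coeff N ((1 - p) ^ j) := by
  have h1 : ∑ j ∈ Finset.range (N + 1), (1 - p) ^ j = f - f * (1 - p) ^ (N + 1) := by
    have := geom_sum_mul_neg (1 - p) (N + 1)
    rw [sub_sub_cancel] at this
    calc _ = (∑ j ∈ Finset.range (N + 1), (1 - p) ^ j) * (f * p) := by rw [h, mul_one]
      _ = f * ((∑ j ∈ Finset.range (N + 1), (1 - p) ^ j) * p) := by ring
      _ = _ := by rw [this]; ring
  have h2 : (X : R⟦X⟧) ^ (N + 1) ∣ f * (1 - p) ^ (N + 1) :=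
    Dvd.dvd.mul_left (pow_dvd_pow_of_dvd (X_dvd_iff.2 (by simp [hp])) _) _
  rw [← map_sum, h1, map_sub, X_pow_dvd_iff.1 h2 N (by omega), sub_zero]

/-- `det (1 - z A)` is the reversed characteristic polynomial, so its coefficient `n` is the
constant term of the characteristic polynomial. -/
theorem coeff_det_oneSubX [Nontrivial R] (A : Matrix (Fin n) (Fin n) R) :
    coeff n (oneSubX A).det = (-1) ^ n * A.det := by
  have h : (oneSubX A).det = (A.charpolyRev : PowerSeries R) := by
    rw [Matrix.charpolyRev, ← Polynomial.coeToPowerSeries.ringHom_apply, RingHom.map_det]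
    congr 1
    ext1 i j
    by_cases hij : i = j <;> simp [oneSubX, hij] <;> exact mul_comm _ _
  rw [h, Polynomial.coeff_coe, ← Matrix.reverse_charpoly, Polynomial.coeff_reverse,
    Matrix.charpoly_natDegree_eq_dim, Fintype.card_fin, Polynomial.revAt_le le_rfl, Nat.sub_self,
    Matrix.det_eq_sign_charpoly_coeff, Fintype.card_fin, ← mul_assoc, ← mul_pow]
  simp

/-- The determinant of an `n × n` matrix is computed, up to sign, by a program of polynomial size
and depth `O(log² n)`. -/
theorem Computes.det [Nontrivial R] {r : ℕ} (hn : n + 1 ≤ 2 ^ r) {A : Set R} (h0 : (0 : R) ∈ A)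
    (h1 : (1 : R) ∈ A) (hneg : (-1 : R) ∈ A) (B : Matrix (Fin n) (Fin n) R)
    (hB : ∀ i j, B i j ∈ A) :
    Computes A {(-1) ^ n * B.det} (9 * (n + 1) ^ 6) (3 * r * (r + 1) + r + 2) := by
  set u : Fin n → R⟦X⟧ := fun k => geomSeries (truncRows B (k + 1)) k k with hu
  set P : R⟦X⟧ := ∏ k, u k with hP
  have hN : 1 ≤ n + 1 := by omega
  -- coefficients of the factors
  have s1 : Computes A (⋃ p ∈ (Finset.univ : Finset (Fin n × Fin (n + 1))),
      {coeff (p.2 : ℕ) (u p.1)}) ((n + 1) ^ 2 * (2 * (n + 1) ^ 4)) (r * (1 + r)) := by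
    refine (biUnion _ fun p _ => ?_).weaken (Nat.mul_le_mul_right _ ?_) le_rfl
    · have := matrix_prod (ν := Fin n) (r := r) (A := A) (by simp; omega) h0 h1 r
        (List.replicate p.2 (truncRows B (p.1 + 1))) (by simp; omega) (by
          intro x hx i j
          rw [List.eq_of_mem_replicate hx, truncRows, Matrix.of_apply]
          split_ifs
          exacts [hB i j, h0])
      refine this.mono subset_rfl ?_ ?_ le_rfl
      · rintro _ rfl
        exact ⟨(p.1, p.1), by simp [hu, geomSeries]⟩
      · simp only [List.length_replicate, Fintype.card_fin]
        have : (p.2 : ℕ) ≤ n + 1 := p.2.2.le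
        calc (p.2 : ℕ) * (n * n * (2 * n)) ≤ (n + 1) * ((n + 1) * (n + 1) * (2 * (n + 1))) := by
              gcongr <;> omega
          _ = _ := by ring
    · simp
      nlinarith
  -- coefficients of the product
  have s2 := powerSeries_prod (r := r) (A := A ∪ ⋃ p ∈ (Finset.univ : Finset (Fin n × Fin (n + 1))),
      {coeff (p.2 : ℕ) (u p.1)}) n hn (Or.inl h0) (Or.inl h1) r (Finset.univ.toList.map u)
      (by simp; omega) (by
        simp only [List.mem_map]
        rintro _ ⟨k, -, rfl⟩ i hi
        exact Or.inr (Set.mem_biUnion (x := (k, (⟨i, by omega⟩ : Fin (n + 1))))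
          (Finset.mem_coe.2 (Finset.mem_univ _)) rfl))
  rw [Finset.prod_map_toList, ← hP] at s2
  have s12 := (s1.trans_union s2).keep
  set A2 := A ∪ ((fun i => coeff i P) '' Finset.range (n + 1)) with hA2
  have s3 : Computes A2 ((fun i => coeff i (1 - P)) '' Finset.range (n + 1)) ((n + 1) * 2) 2 := by
    refine (image _ (s := 2) fun i hi => ?_).weaken (by simp) le_rfl
    have : coeff i (1 - P) = coeff i 1 + (-1) * coeff i P := by simp [sub_eq_add_neg]
    rw [this]
    refine (Computes.mul (A := A2) (Or.inl hneg) (Or.inr ⟨i, hi, rfl⟩)).trans_union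
      (Computes.add (Or.inl (Or.inl ?_)) (Or.inr rfl))
    rw [coeff_one]
    split_ifs <;> assumption
  have s4 : Computes (A2 ∪ (fun i => coeff i (1 - P)) '' Finset.range (n + 1))
      ((fun j => coeff n ((1 - P) ^ j)) '' Finset.range (n + 1))
      ((n + 1) * (2 * (n + 1) ^ 3)) (r * (1 + r)) := by
    refine (image _ (s := 2 * (n + 1) ^ 3) fun j hj => ?_).weaken (by simp) le_rfl
    have hj' : j ≤ n := by simpa [Nat.lt_succ_iff] using hj
    refine (powerSeries_prod (r := r)
      (A := A2 ∪ (fun i => coeff i (1 - P)) '' Finset.range (n + 1)) n hn (Or.inl (Or.inl h0)) (Or.inl (Or.inl h1)) r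
      (List.replicate j (1 - P)) (by simp; omega) (by
        intro x hx i hi
        rw [List.eq_of_mem_replicate hx]
        exact Or.inr ⟨i, by simp; omega, rfl⟩)).mono subset_rfl ?_ ?_ le_rfl
    · rintro _ rfl
      exact ⟨n, by simp, by simp⟩
    · simp only [List.length_replicate]
      calc j * ((n + 1) * (2 * (n + 1))) ≤ (n + 1) * ((n + 1) * (2 * (n + 1))) := by
            gcongr; omega
        _ = _ := by ring
  have s5 := sum_mem (r := r) (A := (A2 ∪ (fun i => coeff i (1 - P)) '' Finset.range (n + 1)) ∪
      (fun j => coeff n ((1 - P) ^ j)) '' Finset.range (n + 1)) (Finset.range (n + 1))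
      (f := fun j => coeff n ((1 - P) ^ j)) (Or.inl (Or.inl (Or.inl h0))) (by simpa using hn)
      (fun j hj => Or.inr ⟨j, hj, rfl⟩)
  have hprod := det_oneSubX_mul_prod B
  have hconst : constantCoeff P = 1 := by
    rw [hP, map_prod]
    refine Finset.prod_eq_one fun k _ => ?_
    simp [hu, geomSeries]
  rw [← coeff_eq_sum_of_mul_eq_one hprod hconst, coeff_det_oneSubX] at s5
  refine (s12.trans (s3.trans_union (s4.trans_union s5))).weaken ?_ ?_
  · simp only [List.length_map, Finset.length_toList, Finset.card_univ, Fintype.card_fin,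
      Finset.card_range]
    have e1 : n * ((n + 1) * (2 * (n + 1))) ≤ 2 * (n + 1) ^ 6 := by
      calc n * ((n + 1) * (2 * (n + 1))) ≤ (n + 1) * ((n + 1) * (2 * (n + 1))) := by gcongr; omega
        _ = 2 * (n + 1) ^ 3 := by ring
        _ ≤ _ := by (gcongr; omega)
    have e2 : n + 1 ≤ (n + 1) ^ 6 := Nat.le_self_pow (by norm_num) _
    have e4 : (n + 1) ^ 4 ≤ (n + 1) ^ 6 := Nat.pow_le_pow_right hN (by norm_num)
    have e5 : (n + 1) ^ 2 * (2 * (n + 1) ^ 4) = 2 * (n + 1) ^ 6 := by ring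
    have e6 : (n + 1) * (2 * (n + 1) ^ 3) = 2 * (n + 1) ^ 4 := by ring
    omega
  -- Three stages of iterated products (matrix powers, the product `P`, powers of `1 - P`) take `r
  -- (r + 1)` each, forming `1 - P` takes `2`, and the final sum takes `r`.
  · apply le_of_eq
    ring

end Chistov

/-! ### Programs for integer polynomials -/

section Polynomials

open MvPolynomial

variable {m : ℕ}

theorem zero_mem_circuitInputs : (0 : MvPolynomial (Fin m) ℚ) ∈ circuitInputs m :=
  Or.inr ⟨0, by simp⟩

theorem one_mem_circuitInputs : (1 : MvPolynomial (Fin m) ℚ) ∈ circuitInputs m :=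
  Or.inr ⟨1, by simp⟩

theorem neg_one_mem_circuitInputs : (-1 : MvPolynomial (Fin m) ℚ) ∈ circuitInputs m :=
  Or.inr ⟨-1, by simp⟩

theorem Computes.natCast {b q N : ℕ} (hN : N < 2 ^ b) (hq : b ≤ 2 ^ q) :
    Computes (circuitInputs m) {(N : MvPolynomial (Fin m) ℚ)} (b * (2 * b + 1)) (2 * q + 1) := by
  have two : Computes (circuitInputs m) {(2 : MvPolynomial (Fin m) ℚ)} 1 1 := by
    rw [← one_add_one_eq_two]
    exact add one_mem_circuitInputs one_mem_circuitInputs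
  have hlt : ∀ i ∈ N.bitIndices.toFinset, i < b := fun i hi => by
    have := Nat.two_pow_le_of_mem_bitIndices (List.mem_toFinset.1 hi)
    exact (Nat.pow_lt_pow_iff_right (by norm_num)).1 (this.trans_lt hN)
  have hcard : N.bitIndices.toFinset.card ≤ b := by
    simpa using Finset.card_le_card (t := Finset.range b)
      (fun i hi => Finset.mem_range.2 (hlt i hi))
  -- Binary expansion, with each power of two built as a separate balanced product.
  have e : (N : MvPolynomial (Fin m) ℚ) =
      ∑ i ∈ N.bitIndices.toFinset, ∏ _j ∈ Finset.range i, (2 : MvPolynomial (Fin m) ℚ) := by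
    simp only [Finset.prod_const, Finset.card_range]
    exact_mod_cast (Finset.sum_toFinset_bitIndices_two_pow N).symm
  rw [e]
  refine (sum (s := 2 * b) (t := 1 + q) (r := q) _ zero_mem_circuitInputs (hcard.trans hq)
    fun i hi => ?_).weaken (Nat.mul_le_mul_right _ hcard) (by omega)
  have := hlt i hi
  exact (prod _ one_mem_circuitInputs (by simp; omega) fun _ _ => two).weaken (by simp; omega)
    le_rfl

theorem Computes.intCast {b q : ℕ} {z : ℤ} (hz : z.natAbs < 2 ^ b) (hq : b ≤ 2 ^ q) :
    Computes (circuitInputs m) {(C (z : ℚ) : MvPolynomial (Fin m) ℚ)} (b * (2 * b + 1) + 1)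
      (2 * q + 2) := by
  -- The sign is itself one of the input constants `-1`, `0`, `1`.
  have h : (C (z : ℚ) : MvPolynomial (Fin m) ℚ) = C ((SignType.sign z : SignType) : ℚ) *
      (z.natAbs : MvPolynomial (Fin m) ℚ) := by
    have h1 : (z : ℚ) = ((SignType.sign z : SignType) : ℚ) * (z.natAbs : ℚ) := by
      conv_lhs => rw [← sign_mul_abs z]
      push_cast
      congr 1
      rcases lt_trichotomy z 0 with h | h | h <;> simp [h]
    rw [← map_natCast (C : ℚ →+* MvPolynomial (Fin m) ℚ), ← C_mul, ← h1]
  rw [h]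
  have hs : Computes (circuitInputs m)
      {(C ((SignType.sign z : SignType) : ℚ) : MvPolynomial (Fin m) ℚ)} 0 (2 * q + 1) :=
    (of_subset (A := circuitInputs m) (Set.singleton_subset_iff.2 (Or.inr ⟨_, rfl⟩))).weaken le_rfl (Nat.zero_le _)
  simpa using hs.mul' (natCast hz hq)

theorem Computes.monomial {b q : ℕ} {a : Fin m →₀ ℕ} (ha : (a.sum fun _ e => e) ≤ b)
    (hq : b ≤ 2 ^ q) :
    Computes (circuitInputs m) {(MvPolynomial.monomial a 1 : MvPolynomial (Fin m) ℚ)} b q := by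
  have e : (MvPolynomial.monomial a 1 : MvPolynomial (Fin m) ℚ) =
      ∏ p ∈ a.support.sigma fun i => Finset.range (a i), X p.1 := by
    rw [Finset.prod_sigma, monomial_eq]
    simp [Finsupp.prod]
  have hc : (a.support.sigma fun i => Finset.range (a i)).card ≤ b := by
    simpa [Finset.card_sigma, Finsupp.sum] using ha
  rw [e]
  exact (prod_mem _ one_mem_circuitInputs (hc.trans hq) fun p _ => Or.inl ⟨_, rfl⟩).weaken hc le_rfl

/-- Polynomials with integer coefficients, at most `b` terms, degree at most `b` and coefficients
of at most `b` bits are computed with polynomially many gates in depth `O(log b)`. -/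
theorem Computes.intPolynomial {b q : ℕ} {f : MvPolynomial (Fin m) ℚ} (hq : b ≤ 2 ^ q)
    (hcard : f.support.card ≤ b) (hdeg : f.totalDegree ≤ b)
    (hcoeff : ∀ a, ∃ z : ℤ, f.coeff a = z ∧ z.natAbs < 2 ^ b) :
    Computes (circuitInputs m) {f} (7 * b ^ 3) (3 * q + 3) := by
  have e : f = ∑ a ∈ f.support, C (f.coeff a) * MvPolynomial.monomial a 1 := by
    conv_lhs => rw [f.as_sum]
    simp [C_mul_monomial]
  rw [e]
  refine (sum (s := b * (2 * b + 1) + 1 + b + 1) (t := 2 * q + 3) (r := q) _ zero_mem_circuitInputs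
    (hcard.trans hq) fun a ha => ?_).weaken ?_ (by omega)
  · obtain ⟨z, hz, hb⟩ := hcoeff a
    rw [hz]
    exact (intCast hb hq).mul' ((monomial ((le_totalDegree ha).trans hdeg) hq).weaken le_rfl
      (by omega))
  · refine (Nat.mul_le_mul_right _ hcard).trans ?_
    rcases Nat.eq_zero_or_pos b with rfl | hb
    · simp
    have h1 : b ≤ b ^ 3 := Nat.le_self_pow (by norm_num) _
    have h2 : b ^ 2 ≤ b ^ 3 := Nat.pow_le_pow_right hb (by norm_num)
    nlinarith

end Polynomials

/-! ### Clearing denominators, and size bounds for the scaled equations -/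

namespace PMC

open MvPolynomial

variable {n m : ℕ} (M : PMC n m)

theorem natAbs_num_coeff_lt (f : MvPolynomial (Fin m) ℚ) (a : Fin m →₀ ℕ) :
    (f.coeff a).num.natAbs < 2 ^ Nat.size (maxCoeff f) := by
  by_cases ha : a ∈ f.support
  · refine lt_of_le_of_lt ?_ (Nat.lt_size_self _)
    exact (le_max_left _ _).trans
      (Finset.le_sup (f := fun a => max (f.coeff a).num.natAbs (f.coeff a).den) ha)
  · rw [notMem_support_iff.1 ha]
    simp

theorem den_coeff_le {f : MvPolynomial (Fin m) ℚ} {a : Fin m →₀ ℕ} (ha : a ∈ f.support) :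
    (f.coeff a).den ≤ 2 ^ Nat.size (maxCoeff f) :=
  ((le_max_right _ _).trans
    (Finset.le_sup (f := fun a => max (f.coeff a).num.natAbs (f.coeff a).den) ha)).trans
      (Nat.lt_size_self _).le

theorem card_support_le_repSize (f : MvPolynomial (Fin m) ℚ) : f.support.card ≤ repSize f := by
  rcases eq_or_ne f 0 with rfl | hf
  · simp
  have h1 : 0 < Nat.size (maxCoeff f) := by
    obtain ⟨a, ha⟩ := Finset.nonempty_iff_ne_empty.2 (mt support_eq_empty.1 hf)
    rw [Nat.size_pos]
    exact lt_of_lt_of_le (lt_max_of_lt_right (f.coeff a).den_pos)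
      (Finset.le_sup (f := fun a => max (f.coeff a).num.natAbs (f.coeff a).den) ha)
  have h2 : 0 < max f.totalDegree 1 := by simp
  rw [repSize, mul_assoc]
  exact Nat.le_mul_of_pos_right _ (Nat.mul_pos h2 h1)

theorem card_mul_size_le_repSize (f : MvPolynomial (Fin m) ℚ) :
    f.support.card * Nat.size (maxCoeff f) ≤ repSize f := by
  rw [repSize]
  exact Nat.mul_le_mul_right _ (Nat.le_mul_of_pos_right _ (by simp))

theorem size_maxCoeff_le_repSize (f : MvPolynomial (Fin m) ℚ) :
    Nat.size (maxCoeff f) ≤ repSize f := by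
  rcases eq_or_ne f 0 with rfl | hf
  · simp [maxCoeff]
  · refine le_trans ?_ (card_mul_size_le_repSize f)
    exact Nat.le_mul_of_pos_left _
      (Finset.card_pos.2 (Finset.nonempty_iff_ne_empty.2 (mt support_eq_empty.1 hf)))

theorem repSize_pos {f : MvPolynomial (Fin m) ℚ} (hf : f ≠ 0) : 0 < repSize f :=
  (Finset.card_pos.2 (Finset.nonempty_iff_ne_empty.2 (mt support_eq_empty.1 hf))).trans_le
    (card_support_le_repSize f)

theorem totalDegree_le_repSize (f : MvPolynomial (Fin m) ℚ) : f.totalDegree ≤ repSize f := by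
  rcases eq_or_ne f 0 with rfl | hf
  · simp
  have h := repSize_pos hf
  rw [repSize] at h ⊢
  have h1 : 0 < f.support.card := by
    by_contra h'
    simp_all
  have h2 : 0 < Nat.size (maxCoeff f) := by
    by_contra h'
    simp_all
  calc f.totalDegree ≤ max f.totalDegree 1 := le_max_left _ _
    _ ≤ f.support.card * max f.totalDegree 1 := Nat.le_mul_of_pos_left _ h1
    _ ≤ _ := Nat.le_mul_of_pos_right _ h2

theorem repSize_le_size (i j : Fin n) : repSize (M.P i j) ≤ M.size :=
  (Finset.single_le_sum (f := fun j => repSize (M.P i j)) (fun _ _ => Nat.zero_le _)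
    (Finset.mem_univ j)).trans
  (Finset.single_le_sum (f := fun i => ∑ j, repSize (M.P i j)) (fun _ _ => Nat.zero_le _)
    (Finset.mem_univ i))

/-- A row that sums to `1` at some valuation has a nonzero entry, and each nonzero entry has
positive representation size. -/
theorem le_size {v : Fin m → ℝ} (hv : M.GraphPreserving v) : n ≤ M.size := by
  have : ∀ i, 1 ≤ ∑ j, repSize (M.P i j) := by
    intro i
    obtain ⟨j, hj⟩ : ∃ j, M.P i j ≠ 0 := by
      by_contra! h
      simpa [h] using hv.2 i
    exact (repSize_pos hj).trans_le
      (Finset.single_le_sum (f := fun j => repSize (M.P i j)) (fun _ _ => Nat.zero_le _)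
        (Finset.mem_univ j))
  calc n = ∑ _i : Fin n, 1 := by simp
    _ ≤ _ := Finset.sum_le_sum fun i _ => this i

/-- The product of the denominators of all coefficients. -/
noncomputable def denProd : ℕ :=
  ∏ i, ∏ j, ∏ a ∈ (M.P i j).support, ((M.P i j).coeff a).den

theorem denProd_pos : 0 < M.denProd :=
  Finset.prod_pos fun _ _ => Finset.prod_pos fun _ _ => Finset.prod_pos fun _ _ => Rat.den_pos _

/-- The bit lengths of all denominators add up to at most the encoding size, as each polynomial is
charged its number of terms times its coefficient length. -/
theorem denProd_le : M.denProd ≤ 2 ^ M.size := by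
  rw [size, ← Finset.prod_pow_eq_pow_sum]
  refine Finset.prod_le_prod' fun i _ => ?_
  rw [← Finset.prod_pow_eq_pow_sum]
  refine Finset.prod_le_prod' fun j _ => ?_
  refine (Finset.prod_le_pow_card _ _ _ fun a ha => den_coeff_le ha).trans ?_
  rw [← pow_mul, mul_comm]
  exact Nat.pow_le_pow_right (by norm_num) (card_mul_size_le_repSize _)

theorem den_dvd_denProd (i j : Fin n) (a : Fin m →₀ ℕ) :
    ((M.P i j).coeff a).den ∣ M.denProd := by
  by_cases ha : a ∈ (M.P i j).support
  · exact (Finset.dvd_prod_of_mem (fun a => ((M.P i j).coeff a).den) ha).trans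
      ((Finset.dvd_prod_of_mem (fun j => ∏ a ∈ (M.P i j).support, ((M.P i j).coeff a).den)
        (Finset.mem_univ j)).trans (Finset.dvd_prod_of_mem (fun i => ∏ j, ∏ a ∈ (M.P i j).support,
          ((M.P i j).coeff a).den) (Finset.mem_univ i)))
  · rw [notMem_support_iff.1 ha]
    simp

theorem exists_int_denProd_mul_coeff (i j : Fin n) (a : Fin m →₀ ℕ) :
    ∃ z : ℤ, (M.denProd : ℚ) * (M.P i j).coeff a = z ∧ z.natAbs ≤ 2 ^ (2 * M.size) := by
  obtain ⟨k, hk⟩ := M.den_dvd_denProd i j a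
  set c := (M.P i j).coeff a with hc
  refine ⟨k * c.num, ?_, ?_⟩
  · rw [hk]
    push_cast
    rw [mul_right_comm, Rat.den_mul_eq_num, mul_comm]
  · rw [Int.natAbs_mul, Int.natAbs_natCast, two_mul, pow_add]
    have hpos : 0 < c.den := c.den_pos
    refine Nat.mul_le_mul (le_trans ?_ M.denProd_le) ?_
    · rw [hk]
      exact Nat.le_mul_of_pos_left _ hpos
    · exact (natAbs_num_coeff_lt _ _).le.trans (Nat.pow_le_pow_right (by norm_num)
        ((size_maxCoeff_le_repSize _).trans (M.repSize_le_size i j)))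

/-- The transition matrix with the rows of the last two states replaced by `0`. -/
noncomputable def polyMatrix : Matrix (Fin n) (Fin n) (MvPolynomial (Fin m) ℚ) :=
  Matrix.of fun i j => if (i : ℕ) + 2 < n then M.P i j else 0

/-- The matrix of the reachability equations, scaled to integer coefficients. -/
noncomputable def scaledMatrix : Matrix (Fin n) (Fin n) (MvPolynomial (Fin m) ℚ) :=
  (C (M.denProd : ℚ) : MvPolynomial (Fin m) ℚ) • (1 - M.polyMatrix)

/-- The right-hand side of the reachability equations, scaled to integer coefficients. -/
noncomputable def scaledRhs : Fin n → MvPolynomial (Fin m) ℚ :=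
  (C (M.denProd : ℚ) : MvPolynomial (Fin m) ℚ) • fun i : Fin n => if (i : ℕ) + 1 = n then 1 else 0

theorem exists_int_coeff_scaledMatrix (hS : 0 < M.size) (i j : Fin n) (a : Fin m →₀ ℕ) :
    ∃ z : ℤ, (M.scaledMatrix i j).coeff a = z ∧ z.natAbs < 2 ^ (4 * M.size) := by
  obtain ⟨z₁, h₁, hb₁⟩ : ∃ z : ℤ, (M.denProd : ℚ) *
      ((1 : Matrix (Fin n) (Fin n) (MvPolynomial (Fin m) ℚ)) i j).coeff a = z ∧
      z.natAbs ≤ 2 ^ (2 * M.size) := by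
    by_cases h : i = j ∧ 0 = a
    · refine ⟨M.denProd, ?_, ?_⟩
      · rw [h.1, Matrix.one_apply_eq, coeff_one, if_pos h.2]
        simp
      · exact M.denProd_le.trans (Nat.pow_le_pow_right (by norm_num) (by omega))
    · refine ⟨0, ?_, by simp⟩
      rw [Matrix.one_apply]
      split_ifs with hij
      · rw [coeff_one, if_neg fun h' => h ⟨hij, h'⟩]
        simp
      · simp
  obtain ⟨z₂, h₂, hb₂⟩ : ∃ z : ℤ, (M.denProd : ℚ) * (M.polyMatrix i j).coeff a = z ∧
      z.natAbs ≤ 2 ^ (2 * M.size) := by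
    rw [polyMatrix, Matrix.of_apply]
    split_ifs with hi
    · exact M.exists_int_denProd_mul_coeff i j a
    · exact ⟨0, by simp⟩
  refine ⟨z₁ - z₂, ?_, ?_⟩
  · rw [scaledMatrix, Matrix.smul_apply, smul_eq_mul, coeff_C_mul, Matrix.sub_apply, coeff_sub,
      mul_sub, h₁, h₂]
    push_cast
    rfl
  · have e : 2 ^ (2 * M.size) + 2 ^ (2 * M.size) < 2 ^ (4 * M.size) := by
      rw [← two_mul, ← pow_succ']
      exact Nat.pow_lt_pow_right (by norm_num) (by omega)
    exact (Int.natAbs_sub_le _ _).trans_lt (by omega)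

theorem card_support_scaledMatrix_le (hS : 0 < M.size) (i j : Fin n) :
    (M.scaledMatrix i j).support.card ≤ 4 * M.size := by
  classical
  have h : (M.scaledMatrix i j).support ⊆ {0} ∪ (M.P i j).support := by
    intro a ha
    by_contra hn
    simp only [Finset.mem_union, Finset.mem_singleton, not_or, notMem_support_iff] at hn
    rw [mem_support_iff, scaledMatrix, Matrix.smul_apply, smul_eq_mul, coeff_C_mul,
      Matrix.sub_apply, coeff_sub, polyMatrix, Matrix.of_apply, Matrix.one_apply] at ha
    apply ha
    split_ifs <;> simp [hn.2, coeff_one, Ne.symm hn.1]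
  have := (Finset.card_le_card h).trans (Finset.card_union_le _ _)
  have := (card_support_le_repSize _).trans (M.repSize_le_size i j)
  simp at *
  omega

theorem totalDegree_scaledMatrix_le (i j : Fin n) :
    (M.scaledMatrix i j).totalDegree ≤ 4 * M.size := by
  have h := (totalDegree_le_repSize _).trans (M.repSize_le_size i j)
  rw [scaledMatrix, Matrix.smul_apply, smul_eq_mul, Matrix.sub_apply]
  refine (totalDegree_mul _ _).trans ?_
  rw [totalDegree_C, zero_add]
  refine (totalDegree_sub _ _).trans (max_le ?_ ?_)
  · rw [Matrix.one_apply]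
    split_ifs <;> simp
  · rw [polyMatrix, Matrix.of_apply]
    split_ifs
    · omega
    · simp

theorem computes_scaledMatrix {q : ℕ} (hS : 0 < M.size) (hq : M.size ≤ 2 ^ q) (i j : Fin n) :
    Computes (circuitInputs m) {M.scaledMatrix i j} (448 * M.size ^ 3) (3 * q + 9) := by
  -- The single bound `4 |M|` covers terms, degree and bits; `448 = 7 * 4 ^ 3`, and the factor `4`
  -- adds `2` to `q`.
  refine (Computes.intPolynomial (b := 4 * M.size) (q := q + 2) (by rw [pow_add]; omega)
    (M.card_support_scaledMatrix_le hS i j) (M.totalDegree_scaledMatrix_le i j)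
    (M.exists_int_coeff_scaledMatrix hS i j)).weaken (le_of_eq (by ring)) (by omega)

theorem computes_scaledRhs {q : ℕ} (hS : 0 < M.size) (hq : M.size ≤ 2 ^ q) (i : Fin n) :
    Computes (circuitInputs m) {M.scaledRhs i} (448 * M.size ^ 3) (3 * q + 9) := by
  have hL : M.denProd < 2 ^ (4 * M.size) :=
    M.denProd_le.trans_lt (Nat.pow_lt_pow_right (by norm_num) (by omega))
  rw [scaledRhs, Pi.smul_apply, smul_eq_mul]
  split_ifs
  · rw [mul_one]
    simp only [map_natCast]
    refine (Computes.natCast hL (q := q + 2) (by rw [pow_add]; omega)).weaken ?_ (by omega)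
    have h1 : M.size ≤ M.size ^ 3 := Nat.le_self_pow (by norm_num) _
    have h2 : M.size ^ 2 ≤ M.size ^ 3 := Nat.pow_le_pow_right hS (by norm_num)
    nlinarith
  · rw [mul_zero]
    exact (Computes.of_subset (Set.singleton_subset_iff.2 zero_mem_circuitInputs)).weaken
      (Nat.zero_le _) (Nat.zero_le _)

/-- Determinants of matrices whose entries are entries of the scaled equations. -/
theorem computes_det {q r : ℕ} (hn : n ≤ M.size) (hS : 0 < M.size) (hq : M.size ≤ 2 ^ q)
    (hr : n + 1 ≤ 2 ^ r) (B : Matrix (Fin n) (Fin n) (MvPolynomial (Fin m) ℚ))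
    (hB : ∀ i j, B i j ∈ Set.range (fun p : Fin n × Fin n => M.scaledMatrix p.1 p.2) ∪
      Set.range M.scaledRhs) :
    Computes (circuitInputs m) {(-1) ^ n * B.det} (2000 * M.size ^ 6)
      (3 * q + 9 + (3 * r * (r + 1) + r + 2)) := by
  have h1 := Computes.image (Finset.univ : Finset (Fin n × Fin n))
    fun p _ => M.computes_scaledMatrix hS hq p.1 p.2
  have h2 := Computes.image (Finset.univ : Finset (Fin n))
    fun i _ => M.computes_scaledRhs hS hq i
  rw [Finset.coe_univ, Set.image_univ] at h1 h2
  refine ((h1.union h2).trans_union (Computes.det (A := circuitInputs m ∪ _) hr (Or.inl zero_mem_circuitInputs)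
    (Or.inl one_mem_circuitInputs) (Or.inl neg_one_mem_circuitInputs) B
    fun i j => Or.inr (hB i j))).weaken ?_ le_rfl
  simp only [Finset.card_univ, Fintype.card_prod, Fintype.card_fin]
  set S := M.size
  have e1 : n * n * (448 * S ^ 3) ≤ 448 * S ^ 6 := by
    calc n * n * (448 * S ^ 3) ≤ S * S * (448 * S ^ 3) := by gcongr
      _ = 448 * S ^ 5 := by ring
      _ ≤ _ := by (gcongr; omega)
  have e2 : n * (448 * S ^ 3) ≤ 448 * S ^ 6 := by
    calc n * (448 * S ^ 3) ≤ S * (448 * S ^ 3) := by gcongr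
      _ = 448 * S ^ 4 := by ring
      _ ≤ _ := by (gcongr; omega)
  have e3 : 9 * (n + 1) ^ 6 ≤ 576 * S ^ 6 := by
    calc 9 * (n + 1) ^ 6 ≤ 9 * (2 * S) ^ 6 := by gcongr; omega
      _ = _ := by ring
  omega

end PMC

/-! ### Nonvanishing, Cramer's rule, and the final bounds -/

namespace PMC

open MvPolynomial

variable {n m : ℕ} (M : PMC n m)

/-- The transition matrix at a valuation, with the rows of the last two states replaced by `0`. -/
noncomputable def evalMatrix (v : Fin m → ℝ) : Matrix (Fin n) (Fin n) ℝ :=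
  M.polyMatrix.map (aeval v)

/-- Maximum principle: where `|x i|` is maximal and row `i` is stochastic, every successor attains
the maximum too. Following a path to the target, one meets a state with a zero row, where `x`
vanishes, so the maximum is `0`. -/
theorem eq_zero_of_evalMatrix_mulVec {v : Fin m → ℝ} (hM : M.Normalized)
    (hv : M.GraphPreserving v) {x : Fin n → ℝ} (hx : M.evalMatrix v *ᵥ x = x) : x = 0 := by
  obtain ⟨hn, hreach⟩ := hM
  have hP : ∀ i j, 0 ≤ aeval v (M.P i j) := fun i j => by
    by_cases h : M.P i j = 0
    · simp [h]
    · exact (hv.1 i j h).1.le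
  have hx0 : ∀ i : Fin n, ¬ (i : ℕ) + 2 < n → x i = 0 := fun i hi => by
    rw [← hx]
    simp [Matrix.mulVec, dotProduct, evalMatrix, polyMatrix, hi]
  have hx1 : ∀ i : Fin n, (i : ℕ) + 2 < n → x i = ∑ j, aeval v (M.P i j) * x j := fun i hi => by
    conv_lhs => rw [← hx]
    simp [Matrix.mulVec, dotProduct, evalMatrix, polyMatrix, hi]
  let t : Fin n := ⟨n - 1, by omega⟩
  have ht : (t : ℕ) + 1 = n := Nat.sub_add_cancel (by omega)
  obtain ⟨k, -, hk⟩ := Finset.exists_max_image Finset.univ (fun i => |x i|) ⟨t, Finset.mem_univ _⟩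
  have step : ∀ i, M.Reaches i t → |x i| = |x k| → x k = 0 := by
    intro i hi
    induction hi using Relation.ReflTransGen.head_induction_on with
    | refl =>
      intro h
      rw [hx0 t (by omega), abs_zero] at h
      exact abs_eq_zero.1 h.symm
    | @head i j hij _ ih =>
      intro h
      by_cases hi : (i : ℕ) + 2 < n
      · apply ih
        by_contra hne
        have hlt : |x j| < |x k| := lt_of_le_of_ne (hk j (Finset.mem_univ _)) hne
        have : |x i| < |x k| := by
          calc |x i| ≤ ∑ l, aeval v (M.P i l) * |x l| := by
                rw [hx1 i hi]
                refine (Finset.abs_sum_le_sum_abs _ _).trans (le_of_eq ?_)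
                exact Finset.sum_congr rfl fun l _ => by rw [abs_mul, abs_of_nonneg (hP i l)]
            _ < ∑ l, aeval v (M.P i l) * |x k| := by
                refine Finset.sum_lt_sum
                  (fun l _ => mul_le_mul_of_nonneg_left (hk l (Finset.mem_univ _)) (hP i l))
                  ⟨j, Finset.mem_univ _, mul_lt_mul_of_pos_left hlt (hv.1 i j hij).1⟩
            _ = |x k| := by rw [← Finset.sum_mul, hv.2 i, one_mul]
        exact this.ne h
      · rw [hx0 i hi, abs_zero] at h
        exact abs_eq_zero.1 h.symm
  -- The state that cannot reach the target has a zero row itself.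
  have hk0 : x k = 0 := by
    by_cases h : (k : ℕ) + 2 = n
    · exact hx0 k (by omega)
    · exact step k ((hreach k t ht).2 h) rfl
  funext i
  have := hk i (Finset.mem_univ _)
  simpa [hk0] using this

theorem aeval_det_scaledMatrix_ne_zero {v : Fin m → ℝ} (hM : M.Normalized)
    (hv : M.GraphPreserving v) : aeval v M.scaledMatrix.det ≠ 0 := by
  have h : (1 - M.evalMatrix v).det ≠ 0 := by
    intro h
    obtain ⟨x, hx, hx0⟩ := Matrix.exists_mulVec_eq_zero_iff.2 h
    rw [Matrix.sub_mulVec, Matrix.one_mulVec, sub_eq_zero] at hx0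
    exact hx (M.eq_zero_of_evalMatrix_mulVec hM hv hx0.symm)
  have e : aeval v M.scaledMatrix.det = (M.denProd : ℝ) ^ n * (1 - M.evalMatrix v).det := by
    rw [scaledMatrix, Matrix.det_smul, map_mul, map_pow, AlgHom.map_det, Fintype.card_fin]
    congr 2
    · simp
    · simp [evalMatrix, AlgHom.mapMatrix_apply, map_sub]
  rw [e]
  exact mul_ne_zero (pow_ne_zero _ (Nat.cast_ne_zero.2 M.denProd_pos.ne')) h

theorem isValueFunctions_iff (hdet : M.scaledMatrix.det ≠ 0)
    (g : Fin n → FractionRing (MvPolynomial (Fin m) ℚ)) :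
    M.IsValueFunctions g ↔ ∀ i, g i =
      algebraMap _ (FractionRing (MvPolynomial (Fin m) ℚ))
        (M.scaledMatrix.updateCol i M.scaledRhs).det /
      algebraMap _ (FractionRing (MvPolynomial (Fin m) ℚ)) M.scaledMatrix.det := by
  let K := FractionRing (MvPolynomial (Fin m) ℚ)
  set φ : MvPolynomial (Fin m) ℚ →+* K := algebraMap _ K with hφ
  have hinj : Function.Injective φ := IsFractionRing.injective _ _
  set B : Matrix (Fin n) (Fin n) K := M.scaledMatrix.map φ with hB
  set b : Fin n → K := φ ∘ M.scaledRhs with hb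
  have hdetB : φ M.scaledMatrix.det = B.det := by
    rw [RingHom.map_det]
    rfl
  have hB0 : B.det ≠ 0 := by
    rw [← hdetB]
    exact (map_ne_zero_iff φ hinj).2 hdet
  have hcol : ∀ i, φ (M.scaledMatrix.updateCol i M.scaledRhs).det = B.cramer b i := by
    intro i
    rw [Matrix.cramer_apply, RingHom.map_det, RingHom.mapMatrix_apply, Matrix.map_updateCol]
  have hL : φ (C (M.denProd : ℚ)) ≠ 0 :=
    (map_ne_zero_iff φ hinj).2 (by simp [M.denProd_pos.ne'])
  have hBA : B = φ (C (M.denProd : ℚ)) • (1 - M.reachMatrix) := by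
    ext i j
    simp only [hB, scaledMatrix, polyMatrix, reachMatrix, Matrix.map_apply, Matrix.smul_apply,
      smul_eq_mul, map_mul, Matrix.sub_apply, map_sub, Matrix.of_apply, Matrix.one_apply]
    congr 2 <;> split_ifs <;> simp [hφ, K]
  have hbe : b = φ (C (M.denProd : ℚ)) • fun i : Fin n => if (i : ℕ) + 1 = n then (1 : K) else 0 := by
    ext i
    simp only [hb, scaledRhs, Function.comp_apply, Pi.smul_apply, smul_eq_mul, map_mul]
    congr 1
    split_ifs <;> simp
  have h1 : M.IsValueFunctions g ↔ B *ᵥ g = b := by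
    rw [IsValueFunctions, hBA, hbe, Matrix.smul_mulVec]
    exact ⟨fun h => by rw [h], fun h => smul_right_injective _ hL h⟩
  rw [h1]
  simp only [hcol, hdetB]
  constructor
  · intro h i
    rw [eq_div_iff hB0, Matrix.cramer_eq_adjugate_mulVec, ← h, Matrix.mulVec_mulVec,
      Matrix.adjugate_mul, Matrix.smul_mulVec, Matrix.one_mulVec, Pi.smul_apply, smul_eq_mul,
      mul_comm]
  · intro h
    have : g = B.det⁻¹ • B.cramer b := by
      ext i
      rw [h i, Pi.smul_apply, smul_eq_mul, div_eq_inv_mul]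
    rw [this, Matrix.mulVec_smul, Matrix.mulVec_cramer, smul_smul, inv_mul_cancel₀ hB0, one_smul]

theorem exists_circuit_det (hn2 : 2 ≤ n) (hn : n ≤ M.size)
    (B : Matrix (Fin n) (Fin n) (MvPolynomial (Fin m) ℚ))
    (hB : ∀ i j, B i j ∈ Set.range (fun p : Fin n × Fin n => M.scaledMatrix p.1 p.2) ∪
      Set.range M.scaledRhs) :
    ∃ E : Circuit m, E.size ≤ M.size ^ 19 ∧
      (E.depth : ℝ) ≤ 56 / Real.log 2 ^ 2 *
        (Real.log (M.size : ℝ) * Real.log ((n * max M.maxDeg 1 : ℕ) : ℝ)) ∧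
      E.poly = (-1) ^ n * B.det := by
  have hS2 : 2 ≤ M.size := hn2.trans hn
  set q := Nat.log 2 M.size + 1 with hq
  set r := Nat.log 2 n + 2 with hr
  obtain ⟨E, hsize, hdepth, hpoly⟩ := (M.computes_det (q := q) (r := r) hn (by omega)
    (Nat.lt_pow_succ_log_self (by norm_num) _).le (by
      have : n < 2 ^ (Nat.log 2 n + 1) := Nat.lt_pow_succ_log_self (by norm_num) n
      rw [hr, show Nat.log 2 n + 2 = Nat.log 2 n + 1 + 1 from rfl, pow_succ]
      omega) B hB).exists_circuit
  refine ⟨E, hsize.trans ?_, ?_, hpoly⟩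
  · have h1 : 1 ≤ M.size ^ 6 := Nat.one_le_pow _ _ (by omega)
    -- Since `|M| ≥ 2`, the constant is absorbed as a power of `|M|`; this gives the exponent `13 +
    -- 6 = 19`.
    calc 4 * (2000 * M.size ^ 6) + 1 ≤ 2 ^ 13 * M.size ^ 6 := by omega
      _ ≤ M.size ^ 13 * M.size ^ 6 := by gcongr
      _ = _ := by rw [← pow_add]
  · have hl2 : 0 < Real.log 2 := Real.log_pos (by norm_num)
    set N := n * max M.maxDeg 1 with hN
    have hnN : n ≤ N := Nat.le_mul_of_pos_right _ (by simp)
    set a := Real.logb 2 M.size with ha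
    set b := Real.logb 2 N with hb
    have ha1 : 1 ≤ a := by
      rw [ha, Real.le_logb_iff_rpow_le (by norm_num) (by exact_mod_cast (by omega : 0 < M.size))]
      exact_mod_cast by simpa using hS2
    have hb1 : 1 ≤ b := by
      rw [hb, Real.le_logb_iff_rpow_le (by norm_num) (by exact_mod_cast (by omega : 0 < N))]
      exact_mod_cast by simpa using hn2.trans hnN
    have hqa : (q : ℝ) ≤ a + 1 := by
      rw [hq]
      push_cast
      have := Real.natLog_le_logb M.size 2
      push_cast at this
      linarith
    have hlogn : (Nat.log 2 n : ℝ) ≤ Real.logb 2 n := by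
      have := Real.natLog_le_logb n 2
      push_cast at this
      exact this
    have hn0 : (0 : ℝ) < n := by exact_mod_cast (by omega : 0 < n)
    have hra : (r : ℝ) ≤ a + 2 := by
      have : Real.logb 2 n ≤ a := Real.logb_le_logb_of_le (by norm_num) hn0 (by exact_mod_cast hn)
      rw [hr]
      push_cast
      linarith
    have hrb : (r : ℝ) ≤ b + 2 := by
      have : Real.logb 2 n ≤ b := Real.logb_le_logb_of_le (by norm_num) hn0 (by exact_mod_cast hnN)
      rw [hr]
      push_cast
      linarith
    have hab : Real.log (M.size : ℝ) * Real.log (N : ℝ) = Real.log 2 ^ 2 * (a * b) := by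
      rw [ha, hb, Real.logb, Real.logb]
      field_simp
    rw [hab, ← mul_assoc, div_mul_cancel₀ _ (by positivity)]
    have hd : (E.depth : ℝ) ≤ 3 * q + 9 + (3 * r * (r + 1) + r + 2) := by exact_mod_cast hdepth
    -- One factor is bounded through `|M|` and the other through `n max(d,1)`. As `a, b ≥ 1`, the
    -- total is at most `36ab + 4a + 16 ≤ 56ab`.
    have hr2 : (r : ℝ) * (r + 1) ≤ (3 * a) * (4 * b) := by
      gcongr
      · linarith
      · linarith
    have h1 : a ≤ a * b := le_mul_of_one_le_right (by linarith) hb1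
    nlinarith

end PMC

theorem mainTheorem3 :
    ∃ (k : ℕ) (c : ℝ), ∀ (n m : ℕ) (M : PMC n m), M.Normalized →
      (∃ v : Fin m → ℝ, M.GraphPreserving v) →
      ∃ N D : Fin n → Circuit m,
        (∀ i, (N i).size ≤ M.size ^ k ∧ (D i).size ≤ M.size ^ k) ∧
        (∀ i,
          ((N i).depth : ℝ) ≤
            c * (Real.log (M.size : ℝ) * Real.log ((n * max M.maxDeg 1 : ℕ) : ℝ)) ∧
          ((D i).depth : ℝ) ≤
            c * (Real.log (M.size : ℝ) * Real.log ((n * max M.maxDeg 1 : ℕ) : ℝ))) ∧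
        (∀ i, (D i).poly ≠ 0 ∧
          ∀ v : Fin m → ℝ, M.GraphPreserving v → MvPolynomial.aeval v (D i).poly ≠ 0) ∧
        (∀ g : Fin n → FractionRing (MvPolynomial (Fin m) ℚ), M.IsValueFunctions g ↔
          ∀ i, g i = algebraMap _ (FractionRing (MvPolynomial (Fin m) ℚ)) (N i).poly /
            algebraMap _ (FractionRing (MvPolynomial (Fin m) ℚ)) (D i).poly) := by
  refine ⟨19, 56 / Real.log 2 ^ 2, fun n m M hM ⟨v, hv⟩ => ?_⟩
  have hn := M.le_size hv
  choose N hN using fun i => M.exists_circuit_det hM.1 hn (M.scaledMatrix.updateCol i M.scaledRhs)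
    fun j k => by
      rw [Matrix.updateCol_apply]
      split_ifs
      · exact Or.inr ⟨j, rfl⟩
      · exact Or.inl ⟨(j, k), rfl⟩
  obtain ⟨D, hD⟩ := M.exists_circuit_det hM.1 hn M.scaledMatrix fun i j => Or.inl ⟨(i, j), rfl⟩
  have hne : ∀ w : Fin m → ℝ, M.GraphPreserving w → MvPolynomial.aeval w D.poly ≠ 0 := by
    intro w hw
    rw [hD.2.2, map_mul, map_pow, map_neg, map_one]
    exact mul_ne_zero (pow_ne_zero _ (by norm_num)) (M.aeval_det_scaledMatrix_ne_zero hM hw)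
  have hdet : M.scaledMatrix.det ≠ 0 := fun h =>
    M.aeval_det_scaledMatrix_ne_zero hM hv (by rw [h, map_zero])
  refine ⟨N, fun _ => D, fun i => ⟨(hN i).1, hD.1⟩, fun i => ⟨(hN i).2.1, hD.2.1⟩,
    fun i => ⟨fun h => hne v hv (by rw [h, map_zero]), hne⟩, fun g => ?_⟩
  rw [M.isValueFunctions_iff hdet]
  refine forall_congr' fun i => ?_
  -- The sign `(-1) ^ n` left by Chistov's method cancels in the quotient.
  rw [(hN i).2.2, hD.2.2, map_mul, map_mul, mul_div_mul_left]
  simp
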